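/- Let $\operatorname{Witt}$ be the complex Lie algebra with basis $\{L_i\}_{i\in\mathbb Z}$ and bracket $[L_i,L_j]=(i-j)L_{i+j}$, and let $\operatorname{Vir}$ be its central extension by $\mathbb C K$ given by the cocycle $\Psi(L_i,L_j)=\frac1{12}(i^3-i)\,\delta_{i+j,0}$. Let $\operatorname{Diff}(\mathbb C[[z]])$ be the Lie algebra, under the commutator, of the differential operators $\sum_{j=0}^k\xi_j\partial^j$ with $k\ge 0$, $\xi_j\in\mathbb C[[z]]$ and $\partial=\frac{d}{dz}$; such an operator has order $k$ if $\xi_k\neq 0$. **Theorem.** Let $\mathfrak g=\operatorname{Witt}$ or $\mathfrak g=\operatorname{Vir}$. The set of Lie algebra homomorphisms $\rho\colon\mathfrak g\to\operatorname{Diff}(\mathbb C[[z]])$ such that $\rho(L_0)$ is of first order is in bijection with the set of triples $(h,b,c)$ with $h,b\in\mathbb C[[z]]$, $c\in\mathbb C$, such that both $h$ and $h'$ are units of $\mathbb C[[z]]$. The bijection sends $(h,b,c)$ to the homomorphism $\rho$ with $$\rho(L_i)=\frac{-h^{i+1}}{h'}\,\partial+(b+i\,c)\,h^i\qquad\text{for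 all } i\in\mathbb Z,$$ and, in the case $\mathfrak g=\operatorname{Vir}$, $\rho(K)=0$. -/

import Mathlib

open scoped PowerSeries

noncomputable section

namespace WittDiff

theorem eq_zero_of_eq_neg {M : Type*} [AddCommGroup M] [Module ℂ M] {x : M} (h : x = -x) :
    x = 0 := by
  have h2 : (2 : ℂ) • x = 0 := by rw [two_smul]; nth_rewrite 1 [h]; simp
  exact (smul_eq_zero.mp h2).resolve_left two_ne_zero

/-! ### The Witt algebra -/

/-- The underlying vector space of the Witt algebra: the complex vector space with basis
`(L_i)`, `i : ℤ`. -/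
def Witt : Type := ℤ →₀ ℂ

namespace Witt

instance : AddCommGroup Witt := inferInstanceAs (AddCommGroup (ℤ →₀ ℂ))
instance : Module ℂ Witt := inferInstanceAs (Module ℂ (ℤ →₀ ℂ))

/-- The basis `(L_i)`, `i : ℤ`. -/
def basis : Module.Basis ℤ ℂ Witt := Module.Basis.ofRepr (LinearEquiv.refl ℂ (ℤ →₀ ℂ))

/-- The basis vector `L_i`. -/
def L (i : ℤ) : Witt := basis i

/-- The bilinear map with `(L_i, L_j) ↦ (i - j) L_{i+j}`. -/
def bracketMap : Witt →ₗ[ℂ] Witt →ₗ[ℂ] Witt :=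
  basis.constr ℂ fun i => basis.constr ℂ fun j => ((i : ℂ) - (j : ℂ)) • L (i + j)

theorem bracketMap_L (i j : ℤ) :
    bracketMap (L i) (L j) = ((i : ℂ) - (j : ℂ)) • L (i + j) := by
  simp [bracketMap, L, Module.Basis.constr_basis]

theorem induction {p : Witt → Prop} (x : Witt) (h0 : p 0)
    (hadd : ∀ x y, p x → p y → p (x + y)) (hL : ∀ (a : ℂ) (i : ℤ), p (a • L i)) : p x := by
  have hx : x ∈ Submodule.span ℂ (Set.range basis) := by rw [basis.span_eq]; trivial
  refine Submodule.span_induction (p := fun x _ => ∀ a : ℂ, p (a • x)) ?_ ?_ ?_ ?_ hx 1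
    |> fun h => by simpa using h
  · rintro _ ⟨i, rfl⟩ a
    exact hL a i
  · intro a
    simpa using h0
  · intro x y _ _ hx hy a
    rw [smul_add]
    exact hadd _ _ (hx a) (hy a)
  · intro b x _ hx a
    rw [smul_smul]
    exact hx _

theorem bracketMap_skew (x y : Witt) : bracketMap x y = -bracketMap y x := by
  induction x using induction with
  | h0 => simp
  | hadd x x' hx hx' => simp [hx, hx', add_comm]
  | hL a i =>
    induction y using induction with
    | h0 => simp
    | hadd y y' hy hy' => rw [map_add, hy, hy']; simp [add_comm]
    | hL b j =>
      simp only [map_smul, LinearMap.smul_apply, bracketMap_L, add_comm j i]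
      module

theorem bracketMap_jacobi (x y z : Witt) :
    bracketMap x (bracketMap y z) =
      bracketMap (bracketMap x y) z + bracketMap y (bracketMap x z) := by
  induction x using induction with
  | h0 => simp
  | hadd x x' hx hx' => simp only [map_add, LinearMap.add_apply, hx, hx']; abel
  | hL a i =>
    induction y using induction with
    | h0 => simp
    | hadd y y' hy hy' => simp only [map_add, LinearMap.add_apply, hy, hy']; abel
    | hL b j =>
      induction z using induction with
      | h0 => simp
      | hadd z z' hz hz' => simp only [map_add, hz, hz']; abel
      | hL c k =>
        simp only [map_smul, LinearMap.smul_apply, bracketMap_L,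
          show j + (i + k) = i + (j + k) by ring, show i + j + k = i + (j + k) by ring]
        push_cast
        module

instance : LieRing Witt where
  bracket x y := bracketMap x y
  add_lie x y z := by simp
  lie_add x y z := by simp
  lie_self x := eq_zero_of_eq_neg (bracketMap_skew x x)
  leibniz_lie x y z := bracketMap_jacobi x y z

instance : LieAlgebra ℂ Witt where
  smul_add := smul_add
  add_smul := add_smul
  smul_zero := smul_zero
  zero_smul := zero_smul ℂ
  lie_smul a x y := map_smul (bracketMap x) a y

theorem lie_eq (x y : Witt) : ⁅x, y⁆ = bracketMap x y := rfl

theorem lie_L (i j : ℤ) : ⁅L i, L j⁆ = ((i : ℂ) - (j : ℂ)) • L (i + j) := bracketMap_L i j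

end Witt

/-! ### The Virasoro algebra -/

/-- The trivial one-dimensional Witt-module. -/
abbrev Center : Type := TrivialLieModule ℂ Witt ℂ

/-- The generator of the trivial one-dimensional Witt-module. -/
def centerOne : Center := (TrivialLieModule.equiv ℂ Witt ℂ).symm 1

/-- The bilinear map `Ψ` with `Ψ(L_i, L_j) = (1/12) (i³ - i) δ_{i+j,0}`. -/
def psiMap : Witt →ₗ[ℂ] Witt →ₗ[ℂ] Center :=
  Witt.basis.constr ℂ fun i => Witt.basis.constr ℂ fun j =>
    (if i + j = 0 then (1 / 12 : ℂ) * ((i : ℂ) ^ 3 - (i : ℂ)) else 0) • centerOne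

theorem psiMap_L (i j : ℤ) :
    psiMap (Witt.L i) (Witt.L j) =
      (if i + j = 0 then (1 / 12 : ℂ) * ((i : ℂ) ^ 3 - (i : ℂ)) else 0) • centerOne := by
  simp only [psiMap, Witt.L, Module.Basis.constr_basis]

theorem psiMap_skew (x y : Witt) : psiMap x y = -psiMap y x := by
  induction x using Witt.induction with
  | h0 => simp
  | hadd x x' hx hx' => simp [hx, hx', add_comm]
  | hL a i =>
    induction y using Witt.induction with
    | h0 => simp
    | hadd y y' hy hy' => rw [map_add, hy, hy']; simp [add_comm]
    | hL b j =>
      simp only [map_smul, LinearMap.smul_apply, psiMap_L, add_comm j i]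
      split_ifs with h
      · obtain rfl : j = -i := by omega
        push_cast
        module
      · simp

theorem psiMap_cocycle (x y z : Witt) :
    psiMap x ⁅y, z⁆ = psiMap ⁅x, y⁆ z + psiMap y ⁅x, z⁆ := by
  simp only [Witt.lie_eq]
  induction x using Witt.induction with
  | h0 => simp
  | hadd x x' hx hx' => simp only [map_add, LinearMap.add_apply, hx, hx']; abel
  | hL a i =>
    induction y using Witt.induction with
    | h0 => simp
    | hadd y y' hy hy' => simp only [map_add, LinearMap.add_apply, hy, hy']; abel
    | hL b j =>
      induction z using Witt.induction with
      | h0 => simp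
      | hadd z z' hz hz' => simp only [map_add, hz, hz']; abel
      | hL c k =>
        simp only [map_smul, LinearMap.smul_apply, Witt.bracketMap_L, psiMap_L,
          show j + (i + k) = i + (j + k) by ring, show i + j + k = i + (j + k) by ring]
        split_ifs with h
        · obtain rfl : k = -i - j := by omega
          push_cast
          module
        · simp

/-- The Virasoro cocycle `Ψ` of the Witt algebra with values in the trivial module. -/
def psi : LieModule.Cohomology.twoCocycle ℂ Witt Center :=
  ⟨⟨psiMap, fun x => eq_zero_of_eq_neg (psiMap_skew x x)⟩,
    (LieModule.Cohomology.mem_twoCocycle_iff_of_trivial ℂ Witt Center _).2 psiMap_cocycle⟩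

/-- The Virasoro algebra: the central extension of the Witt algebra by `ℂ` attached to the
cocycle `Ψ`. -/
abbrev Vir : Type := LieAlgebra.ofTwoCocycle psi

namespace Vir

/-- The element `L_i` of the Virasoro algebra. -/
def L (i : ℤ) : Vir := LieAlgebra.ofProd psi (Witt.L i, 0)

/-- The central element `K` of the Virasoro algebra. -/
def K : Vir := LieAlgebra.ofProd psi (0, centerOne)

theorem lie_L (i j : ℤ) :
    ⁅L i, L j⁆ = ((i : ℂ) - (j : ℂ)) • L (i + j) +
      (if i + j = 0 then (1 / 12 : ℂ) * ((i : ℂ) ^ 3 - (i : ℂ)) else 0) • K := by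
  rw [LieAlgebra.bracket_ofTwoCocycle]
  simp only [L, K, ← LieAlgebra.of_smul, ← LieAlgebra.of_add, Equiv.symm_apply_apply]
  congr 1
  have h : (psi : Witt →ₗ[ℂ] Witt →ₗ[ℂ] Center) (Witt.L i) (Witt.L j) = _ := psiMap_L i j
  rw [h, Witt.lie_L]
  ext1 <;> simp only [Prod.fst_add, Prod.snd_add, Prod.smul_fst, Prod.smul_snd, smul_zero,
    lie_zero, add_zero, zero_add, sub_zero]

theorem lie_K (x : Vir) : ⁅x, K⁆ = 0 := by
  rw [LieAlgebra.bracket_ofTwoCocycle]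
  simp only [K, Equiv.symm_apply_apply]
  rw [← LieAlgebra.of_zero]
  congr 1
  ext1
  · simp
  · simp [LieModule.IsTrivial.trivial]

end Vir

/-! ### Differential operators on `ℂ⟦z⟧` -/

/-- The derivation `∂ = d/dz` of `ℂ⟦z⟧`, as a linear operator. -/
def del : Module.End ℂ ℂ⟦X⟧ := (PowerSeries.derivative ℂ).toLinearMap

/-- Multiplication by `f`, as a linear operator on `ℂ⟦z⟧`. -/
def mulOp (f : ℂ⟦X⟧) : Module.End ℂ ℂ⟦X⟧ := LinearMap.mulLeft ℂ f

/-- The operator `∑_j ξ_j ∂^j`, for a finitely supported family of coefficients `ξ_j ∈ ℂ⟦z⟧`. -/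
def diffOp (ξ : ℕ →₀ ℂ⟦X⟧) : Module.End ℂ ℂ⟦X⟧ := ξ.sum fun j f => mulOp f * del ^ j

theorem diffOp_zero : diffOp 0 = 0 := by simp [diffOp]

theorem diffOp_single (j : ℕ) (f : ℂ⟦X⟧) :
    diffOp (Finsupp.single j f) = mulOp f * del ^ j := by
  simp [diffOp, mulOp]

theorem diffOp_add (ξ η : ℕ →₀ ℂ⟦X⟧) : diffOp (ξ + η) = diffOp ξ + diffOp η := by
  unfold diffOp
  refine Finsupp.sum_add_index' (fun j => ?_) (fun j f g => ?_)
  · simp [mulOp]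
  · ext x : 1
    simp [mulOp, add_mul]

theorem mulOp_mul_mulOp (f g : ℂ⟦X⟧) : mulOp f * mulOp g = mulOp (f * g) := by
  ext x : 1
  simp [mulOp]

theorem del_mul_mulOp (f : ℂ⟦X⟧) :
    del * mulOp f = mulOp f * del + mulOp (PowerSeries.derivative ℂ f) := by
  ext x : 1
  simp [mulOp, del, mul_comm]

theorem exists_mulOp_mul (f : ℂ⟦X⟧) (η : ℕ →₀ ℂ⟦X⟧) : ∃ ζ, mulOp f * diffOp η = diffOp ζ := by
  induction η using Finsupp.induction_linear with
  | zero => exact ⟨0, by simp [diffOp_zero]⟩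
  | add η η' h h' =>
    obtain ⟨ζ, h⟩ := h
    obtain ⟨ζ', h'⟩ := h'
    exact ⟨ζ + ζ', by rw [diffOp_add, diffOp_add, mul_add, h, h']⟩
  | single j g =>
    exact ⟨Finsupp.single j (f * g), by
      rw [diffOp_single, diffOp_single, ← mul_assoc, mulOp_mul_mulOp]⟩

theorem exists_del_mul (η : ℕ →₀ ℂ⟦X⟧) : ∃ ζ, del * diffOp η = diffOp ζ := by
  induction η using Finsupp.induction_linear with
  | zero => exact ⟨0, by simp [diffOp_zero]⟩
  | add η η' h h' =>
    obtain ⟨ζ, h⟩ := h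
    obtain ⟨ζ', h'⟩ := h'
    exact ⟨ζ + ζ', by rw [diffOp_add, diffOp_add, mul_add, h, h']⟩
  | single j g =>
    exact ⟨Finsupp.single (j + 1) g + Finsupp.single j (PowerSeries.derivative ℂ g), by
      rw [diffOp_add, diffOp_single, diffOp_single, diffOp_single, ← mul_assoc, del_mul_mulOp,
        add_mul, mul_assoc, ← pow_succ']⟩

theorem exists_diffOp_mul (ξ η : ℕ →₀ ℂ⟦X⟧) : ∃ ζ, diffOp ξ * diffOp η = diffOp ζ := by
  induction ξ using Finsupp.induction_linear with
  | zero => exact ⟨0, by simp [diffOp_zero]⟩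
  | add ξ ξ' h h' =>
    obtain ⟨ζ, h⟩ := h
    obtain ⟨ζ', h'⟩ := h'
    exact ⟨ζ + ζ', by rw [diffOp_add, diffOp_add, add_mul, h, h']⟩
  | single j f =>
    have key : ∀ (j : ℕ), ∃ ζ, del ^ j * diffOp η = diffOp ζ := by
      intro j
      induction j with
      | zero => exact ⟨η, by simp⟩
      | succ j ih =>
        obtain ⟨ζ, h⟩ := ih
        obtain ⟨ζ', h'⟩ := exists_del_mul ζ
        exact ⟨ζ', by rw [pow_succ', mul_assoc, h, h']⟩
    obtain ⟨ζ, h⟩ := key j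
    obtain ⟨ζ', h'⟩ := exists_mulOp_mul f ζ
    exact ⟨ζ', by rw [diffOp_single, mul_assoc, h, h']⟩

/-- The algebra `Diff(ℂ⟦z⟧)` of differential operators on `ℂ⟦z⟧`: the finite sums
`∑_j ξ_j ∂^j` with `ξ_j ∈ ℂ⟦z⟧`. -/
def Diff : Subalgebra ℂ (Module.End ℂ ℂ⟦X⟧) where
  carrier := {P | ∃ ξ : ℕ →₀ ℂ⟦X⟧, P = diffOp ξ}
  mul_mem' := by
    rintro _ _ ⟨ξ, rfl⟩ ⟨η, rfl⟩
    exact exists_diffOp_mul ξ η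
  add_mem' := by
    rintro _ _ ⟨ξ, rfl⟩ ⟨η, rfl⟩
    exact ⟨ξ + η, (diffOp_add ξ η).symm⟩
  algebraMap_mem' a := ⟨Finsupp.single 0 (PowerSeries.C a), by
    rw [diffOp_single]
    ext x : 1
    simp [mulOp, PowerSeries.smul_eq_C_mul]⟩

/-- `Diff(ℂ⟦z⟧)` is a Lie algebra under the commutator. -/
instance : LieRing Diff := LieRing.ofAssociativeRing
instance : LieAlgebra ℂ Diff := LieAlgebra.ofAssociativeAlgebra

/-- `P` has order `k`: it is `∑_{j ≤ k} ξ_j ∂^j` with `ξ_k ≠ 0`. -/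
def HasOrder (P : Module.End ℂ ℂ⟦X⟧) (k : ℕ) : Prop :=
  ∃ ξ : ℕ →₀ ℂ⟦X⟧, P = diffOp ξ ∧ ξ k ≠ 0 ∧ ∀ j, k < j → ξ j = 0

/-! ### The parameters and the two sets of homomorphisms -/

/-- The triples `(h, b, c)` with `h, b ∈ ℂ⟦z⟧`, `c ∈ ℂ`, such that `h` and `h'` are units
of `ℂ⟦z⟧`. -/
structure Triple where
  h : ℂ⟦X⟧
  b : ℂ⟦X⟧
  c : ℂ
  isUnit_h : IsUnit h
  isUnit_dh : IsUnit (PowerSeries.derivative ℂ h)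

namespace Triple

/-- The integral power `h^i`. -/
def hpow (t : Triple) (i : ℤ) : ℂ⟦X⟧ := ((t.isUnit_h.unit ^ i : ℂ⟦X⟧ˣ) : ℂ⟦X⟧)

/-- The inverse `1/h'`. -/
def dhInv (t : Triple) : ℂ⟦X⟧ := ((t.isUnit_dh.unit⁻¹ : ℂ⟦X⟧ˣ) : ℂ⟦X⟧)

/-- The operator `-(h^{i+1}/h') ∂ + (b + i c) h^i`. -/
def op (t : Triple) (i : ℤ) : Module.End ℂ ℂ⟦X⟧ :=
  mulOp (-(t.hpow (i + 1) * t.dhInv)) * del +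
    mulOp ((t.b + PowerSeries.C ((i : ℂ) * t.c)) * t.hpow i)

end Triple

/-- Lie algebra homomorphisms `ρ : Witt → Diff(ℂ⟦z⟧)` with `ρ(L_0)` of first order. -/
abbrev WittHoms : Type :=
  {ρ : Witt →ₗ⁅ℂ⁆ Diff // HasOrder (ρ (Witt.L 0) : Module.End ℂ ℂ⟦X⟧) 1}

/-- Lie algebra homomorphisms `ρ : Vir → Diff(ℂ⟦z⟧)` with `ρ(L_0)` of first order. -/
abbrev VirHoms : Type :=
  {ρ : Vir →ₗ⁅ℂ⁆ Diff // HasOrder (ρ (Vir.L 0) : Module.End ℂ ℂ⟦X⟧) 1}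

end WittDiff

end

/-! Order is read off from `adX`, the commutator with z: a nonzero differential operator P has order
n exactly when `(adX ^ n) P` is multiplication by a nonzero series, its symbol up to the factor n!.
The symbol of a commutator is the Poisson bracket of the symbols.

Let ξ be the symbol of ρ(L_0). Since ρ(L_i) is an eigenvector of the commutator with ρ(L_0), its
symbol a, of order n_i, satisfies ξa' = n_i aξ' - ia. For two such eigenvectors, ξ times the Poisson
bracket of the symbols is therefore a numerical multiple of their product (`HasSymbol.lie_eigen`),
so whether the top symbol of a commutator survives is a question about binomial coefficients. This
makes ρ(K) a scalar κ, and [L_i, L_{-i}] gives n_i + n_{-i} = 2 for i ≠ 0; the relation [L_{2i},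
L_{-i}] = 3i L_i then leaves only n_i = 1 (`IsVirFamily.exists_eq`).

Now ρ(L_i) = a_i ∂ + b_i. The relations yield a_i a_j = a_0 a_{i+j}, and a valuation argument yields
a_0 ∣ a_i, so a_i = a_0 h^i with h a unit (`exists_factor`). From a_0 h' = -h, also h' is a unit and
a_0 = -h/h'. Bracketing with L_0 gives b_i = (b_0 + γ_i) h^i with γ_i constant, and the remaining
relations are linear in γ and κ: they force γ_i = iγ_1 and κ = 0 (`eq_linear_of_relations`).
Conversely, h^i is an eigenvector of (-h/h')∂ with eigenvalue -i, which gives the Witt relations. -/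

noncomputable section

namespace WittDiff

/-! ### Commutators with z -/

/-- The commutator with multiplication by the coordinate `z`. -/
def adX : Module.End ℂ (Module.End ℂ ℂ⟦X⟧) :=
  LinearMap.mulRight ℂ (mulOp PowerSeries.X) - LinearMap.mulLeft ℂ (mulOp PowerSeries.X)

theorem adX_apply (P : Module.End ℂ ℂ⟦X⟧) :
    adX P = P * mulOp PowerSeries.X - mulOp PowerSeries.X * P := rfl

theorem mulOp_apply (f x : ℂ⟦X⟧) : mulOp f x = f * x := rfl

theorem del_apply (x : ℂ⟦X⟧) : del x = PowerSeries.derivative ℂ x := rfl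

theorem mulOp_injective : Function.Injective mulOp := fun f g h => by
  simpa [mulOp_apply] using LinearMap.congr_fun h 1

theorem mulOp_zero : mulOp 0 = 0 := by ext x : 1; simp [mulOp_apply]

theorem mulOp_add (f g : ℂ⟦X⟧) : mulOp (f + g) = mulOp f + mulOp g := by
  ext x : 1; simp [mulOp_apply, add_mul]

theorem mulOp_sub (f g : ℂ⟦X⟧) : mulOp (f - g) = mulOp f - mulOp g := by
  ext x : 1; simp [mulOp_apply, sub_mul]

theorem mulOp_smul (r : ℂ) (f : ℂ⟦X⟧) : mulOp (r • f) = r • mulOp f := by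
  ext x : 1; simp [mulOp_apply]

theorem mulOp_mem_Diff (f : ℂ⟦X⟧) : mulOp f ∈ Diff :=
  ⟨Finsupp.single 0 f, by simp [diffOp_single]⟩

theorem del_mem_Diff : del ∈ Diff :=
  ⟨Finsupp.single 1 1, by ext x : 1; simp [diffOp_single, mulOp_apply]⟩

theorem adX_mem_Diff {P : Module.End ℂ ℂ⟦X⟧} (hP : P ∈ Diff) : adX P ∈ Diff :=
  sub_mem (mul_mem hP (mulOp_mem_Diff _)) (mul_mem (mulOp_mem_Diff _) hP)

theorem adX_mulOp (f : ℂ⟦X⟧) : adX (mulOp f) = 0 := by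
  rw [adX_apply, mulOp_mul_mulOp, mulOp_mul_mulOp, mul_comm, sub_self]

theorem adX_mul (P Q : Module.End ℂ ℂ⟦X⟧) : adX (P * Q) = adX P * Q + P * adX Q := by
  simp only [adX_apply, sub_mul, mul_sub, mul_assoc]; abel

theorem lie_swap (P Q : Module.End ℂ ℂ⟦X⟧) : ⁅P, Q⁆ = -⁅Q, P⁆ := by
  simp only [Ring.lie_def, neg_sub]

theorem adX_lie (P Q : Module.End ℂ ℂ⟦X⟧) : adX ⁅P, Q⁆ = ⁅adX P, Q⁆ + ⁅P, adX Q⁆ := by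
  simp only [Ring.lie_def, map_sub, adX_mul]; abel

theorem adX_del : adX del = 1 := by
  rw [adX_apply, del_mul_mulOp, PowerSeries.derivative_X]
  ext x : 1; simp [mulOp_apply]

theorem adX_del_pow (j : ℕ) : adX (del ^ (j + 1)) = (j + 1 : ℂ) • del ^ j := by
  induction j with
  | zero => simp [adX_del]
  | succ j ih =>
    rw [pow_succ, adX_mul, ih, adX_del, smul_mul_assoc, ← pow_succ, mul_one]
    push_cast
    module

theorem adX_pow_mulOp_mul_del_pow (f : ℂ⟦X⟧) {j n : ℕ} (h : j < n) :
    (adX ^ n) (mulOp f * del ^ j) = 0 := by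
  induction n generalizing j with
  | zero => omega
  | succ n ih =>
    rw [pow_succ, Module.End.mul_apply, adX_mul, adX_mulOp, zero_mul, zero_add]
    cases j with
    | zero => simpa [mulOp] using by rw [show adX 1 = 0 by simp [adX_apply]]; simp
    | succ j =>
      rw [adX_del_pow, mul_smul_comm, map_smul, ih (by omega), smul_zero]

theorem exists_adX_pow_eq_zero {P : Module.End ℂ ℂ⟦X⟧} (hP : P ∈ Diff) :
    ∃ n, (adX ^ n) P = 0 := by
  obtain ⟨ξ, rfl⟩ := hP
  refine ⟨ξ.support.sup id + 1, ?_⟩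
  rw [diffOp, Finsupp.sum, map_sum]
  exact Finset.sum_eq_zero fun j hj => adX_pow_mulOp_mul_del_pow _
    (Nat.lt_succ_of_le (Finset.le_sup (f := id) hj))

theorem del_pow_X_pow_self (j : ℕ) :
    (del ^ j) (PowerSeries.X ^ j) = ((j.factorial : ℂ) • 1 : ℂ⟦X⟧) := by
  induction j with
  | zero => simp
  | succ j ih =>
    rw [pow_succ, Module.End.mul_apply, del_apply, Derivation.leibniz_pow]
    simp only [PowerSeries.derivative_X, smul_eq_mul, mul_one, Nat.add_sub_cancel, map_nsmul, ih]
    rw [Nat.factorial_succ, ← Nat.cast_smul_eq_nsmul ℂ, smul_smul]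
    push_cast; rfl

theorem del_pow_X_pow_of_lt {j k : ℕ} (h : k < j) : (del ^ j) (PowerSeries.X ^ k) = 0 := by
  obtain ⟨i, rfl⟩ : ∃ i, j = i + 1 + k := ⟨j - k - 1, by omega⟩
  rw [pow_add, Module.End.mul_apply, del_pow_X_pow_self, map_smul, pow_succ,
    Module.End.mul_apply, del_apply, Derivation.map_one_eq_zero, map_zero, smul_zero]

/-- A differential operator that kills every power of the coordinate is zero. -/
theorem eq_zero_of_apply_X_pow {P : Module.End ℂ ℂ⟦X⟧} (hP : P ∈ Diff)
    (h : ∀ k : ℕ, P (PowerSeries.X ^ k) = 0) : P = 0 := by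
  obtain ⟨ξ, rfl⟩ := hP
  suffices hξ : ∀ k, ξ k = 0 by
    rw [show ξ = 0 from Finsupp.ext hξ, diffOp_zero]
  intro k
  induction k using Nat.strong_induction_on with
  | _ k ih =>
    have hk := h k
    rw [diffOp, Finsupp.sum, LinearMap.sum_apply, Finset.sum_eq_single k] at hk
    · rw [Module.End.mul_apply, del_pow_X_pow_self, mulOp_apply, mul_smul_comm, mul_one] at hk
      exact (smul_eq_zero.mp hk).resolve_left (by exact_mod_cast k.factorial_ne_zero)
    -- The system is triangular: coefficients below k vanish by induction, and ∂^j kills z^k for j >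
    -- k.
    · intro j _ hj
      rcases lt_or_gt_of_ne hj with hj | hj
      · rw [ih j hj, mulOp_zero, zero_mul, LinearMap.zero_apply]
      · rw [Module.End.mul_apply, del_pow_X_pow_of_lt hj, map_zero]
    · intro hk'
      rw [Finsupp.notMem_support_iff.mp hk', mulOp_zero, zero_mul, LinearMap.zero_apply]

/-- Commuting with z determines P on all powers of z from its value at 1, and these powers separate
differential operators. -/
theorem eq_mulOp_of_adX_eq_zero {P : Module.End ℂ ℂ⟦X⟧} (hP : P ∈ Diff) (h : adX P = 0) :
    P = mulOp (P 1) := by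
  refine sub_eq_zero.mp (eq_zero_of_apply_X_pow (sub_mem hP (mulOp_mem_Diff _)) fun k => ?_)
  rw [LinearMap.sub_apply, sub_eq_zero]
  induction k with
  | zero => simp [mulOp_apply]
  | succ k ih =>
    have := LinearMap.congr_fun h (PowerSeries.X ^ k)
    rw [adX_apply, LinearMap.sub_apply, Module.End.mul_apply, Module.End.mul_apply, mulOp_apply,
      mulOp_apply, LinearMap.zero_apply, sub_eq_zero, ← pow_succ'] at this
    rw [this, ih, mulOp_apply, mulOp_apply]
    ring

/-! ### Symbols and their Poisson bracket -/

/-- `P` is a differential operator with `ad_z^n P` the multiplication by `a`: up to the factor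
`n!`, the coefficient of `∂^n` in `P` is `a`, and the higher coefficients vanish. -/
def HasSymbol (n : ℕ) (a : ℂ⟦X⟧) (P : Module.End ℂ ℂ⟦X⟧) : Prop :=
  P ∈ Diff ∧ (adX ^ n) P = mulOp a

namespace HasSymbol

variable {n m : ℕ} {a b : ℂ⟦X⟧} {P Q : Module.End ℂ ℂ⟦X⟧}

theorem adX_succ (h : HasSymbol (n + 1) a P) : HasSymbol n a (adX P) :=
  ⟨adX_mem_Diff h.1, by rw [← h.2, pow_succ, Module.End.mul_apply]⟩

theorem eq_mulOp (h : HasSymbol 0 a P) : P = mulOp a := by simpa using h.2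

theorem of_lt (h : HasSymbol n a P) (hnm : n < m) : HasSymbol m 0 P := by
  refine ⟨h.1, ?_⟩
  obtain ⟨k, rfl⟩ : ∃ k, m = k + 1 + n := ⟨m - n - 1, by omega⟩
  rw [pow_add, Module.End.mul_apply, h.2, pow_succ, Module.End.mul_apply, adX_mulOp, map_zero,
    mulOp_zero]

theorem unique (h : HasSymbol n a P) (h' : HasSymbol n b P) : a = b :=
  mulOp_injective (h.2.symm.trans h'.2)

theorem le (h : HasSymbol n a P) (h' : HasSymbol m b P) (ha : a ≠ 0) : n ≤ m := by
  by_contra hlt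
  exact ha (h.unique (h'.of_lt (not_le.mp hlt)))

theorem ne_zero (h : HasSymbol n a P) (ha : a ≠ 0) : P ≠ 0 := by
  rintro rfl
  refine ha (mulOp_injective ?_)
  rw [← h.2, map_zero, mulOp_zero]

theorem smul (h : HasSymbol n a P) (r : ℂ) : HasSymbol n (r • a) (r • P) :=
  ⟨Subalgebra.smul_mem _ h.1 r, by rw [map_smul, h.2, mulOp_smul]⟩

theorem add (h : HasSymbol n a P) (h' : HasSymbol n b Q) : HasSymbol n (a + b) (P + Q) :=
  ⟨add_mem h.1 h'.1, by rw [map_add, h.2, h'.2, mulOp_add]⟩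

theorem sub (h : HasSymbol n a P) (h' : HasSymbol n b Q) : HasSymbol n (a - b) (P - Q) :=
  ⟨sub_mem h.1 h'.1, by rw [map_sub, h.2, h'.2, mulOp_sub]⟩

theorem mulOp (f : ℂ⟦X⟧) : HasSymbol 0 f (mulOp f) := ⟨mulOp_mem_Diff f, rfl⟩

theorem exists_of_ne_zero (hP : P ∈ Diff) (h0 : P ≠ 0) : ∃ n a, a ≠ 0 ∧ HasSymbol n a P := by
  classical
  have hex := exists_adX_pow_eq_zero hP
  -- The order is one less than the first power of `adX` that kills P.
  obtain ⟨n, hn⟩ : ∃ n, Nat.find hex = n + 1 :=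
    Nat.exists_eq_succ_of_ne_zero fun h => h0 (by simpa [h] using Nat.find_spec hex)
  have hne : (adX ^ n) P ≠ 0 := Nat.find_min hex (by omega)
  have hmem : (adX ^ n) P ∈ Diff := by
    clear hn hne
    induction n with
    | zero => simpa using hP
    | succ n ih => rw [pow_succ', Module.End.mul_apply]; exact adX_mem_Diff ih
  have hz : adX ((adX ^ n) P) = 0 := by
    have := Nat.find_spec hex
    rwa [hn, pow_succ', Module.End.mul_apply] at this
  have heq := eq_mulOp_of_adX_eq_zero hmem hz
  refine ⟨n, _, fun h => hne ?_, hP, heq⟩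
  rw [heq, h, mulOp_zero]

theorem mulOp_mul_del_add (a b : ℂ⟦X⟧) :
    HasSymbol 1 a (WittDiff.mulOp a * del + WittDiff.mulOp b) :=
  ⟨add_mem (mul_mem (mulOp_mem_Diff _) del_mem_Diff) (mulOp_mem_Diff _), by
    rw [pow_one, map_add, adX_mul, adX_mulOp, adX_mulOp, adX_del]; simp⟩

theorem exists_eq (h : HasSymbol 1 a P) :
    ∃ b, P = WittDiff.mulOp a * del + WittDiff.mulOp b := by
  have h1 := h.sub (mulOp_mul_del_add a 0)
  rw [sub_self, mulOp_zero, add_zero] at h1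
  have h2 := eq_mulOp_of_adX_eq_zero h1.1 (by simpa [mulOp_zero] using h1.2)
  exact ⟨_, by rw [← h2]; abel⟩

/-- The factor m + 1 from differentiating ∂^(m+1) is absorbed by the factorial normalization of the
symbols. -/
theorem lie_mulOp_left (h : HasSymbol (m + 1) b Q) (f : ℂ⟦X⟧) :
    HasSymbol m (-(b * PowerSeries.derivative ℂ f)) ⁅WittDiff.mulOp f, Q⁆ := by
  induction m generalizing Q with
  | zero =>
    obtain ⟨c, rfl⟩ := h.exists_eq
    convert HasSymbol.mulOp (-(b * PowerSeries.derivative ℂ f)) using 1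
    ext x : 1
    simp [Ring.lie_def, mulOp_apply, del_apply, Derivation.leibniz]
    ring
  | succ m ih =>
    have h1 := ih h.adX_succ
    refine ⟨sub_mem (mul_mem (mulOp_mem_Diff f) h.1) (mul_mem h.1 (mulOp_mem_Diff f)), ?_⟩
    rw [pow_succ, Module.End.mul_apply, adX_lie, adX_mulOp, Ring.lie_def 0, zero_mul, mul_zero,
      sub_zero, zero_add, h1.2]

theorem neg (h : HasSymbol n a P) : HasSymbol n (-a) (-P) := by
  rw [← neg_one_smul ℂ a, ← neg_one_smul ℂ P]; exact h.smul (-1)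

/-- The symbol of a commutator is the Poisson bracket of the symbols. -/
theorem lie {N : ℕ} (hP : HasSymbol n a P) (hQ : HasSymbol m b Q) (hN : n + m = N + 1) :
    HasSymbol N ((N.choose m : ℂ) • (a * PowerSeries.derivative ℂ b) -
      (N.choose n : ℂ) • (b * PowerSeries.derivative ℂ a)) ⁅P, Q⁆ := by
  induction N generalizing n m P Q with
  | zero =>
    obtain ⟨rfl, rfl⟩ | ⟨rfl, rfl⟩ : n = 0 ∧ m = 1 ∨ n = 1 ∧ m = 0 := by omega
    · rw [hP.eq_mulOp]
      simpa using hQ.lie_mulOp_left a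
    · rw [hQ.eq_mulOp, lie_swap]
      simpa using (hP.lie_mulOp_left b).neg
  | succ N ih =>
    cases n with
    | zero =>
      obtain rfl : m = N + 2 := by omega
      rw [hP.eq_mulOp]
      simpa using hQ.lie_mulOp_left a
    | succ n =>
      cases m with
      | zero =>
        obtain rfl : n = N + 1 := by omega
        rw [hQ.eq_mulOp, lie_swap]
        simpa using (hP.lie_mulOp_left b).neg
      | succ m =>
        have h1 := ih hP.adX_succ hQ (by omega)
        have h2 := ih hP hQ.adX_succ (by omega)
        refine ⟨sub_mem (mul_mem hP.1 hQ.1) (mul_mem hQ.1 hP.1), ?_⟩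
        -- `adX` is a derivation of the bracket, so the two smaller cases add up by Pascal's rule.
        rw [pow_succ, Module.End.mul_apply, adX_lie, map_add, h1.2, h2.2, ← mulOp_add,
          Nat.choose_succ_succ, Nat.choose_succ_succ]
        congr 1
        push_cast
        module

end HasSymbol

theorem HasOrder.exists_hasSymbol {P : Module.End ℂ ℂ⟦X⟧} (h : HasOrder P 1) :
    ∃ a, a ≠ 0 ∧ HasSymbol 1 a P := by
  obtain ⟨ξ, rfl, h1, h2⟩ := h
  refine ⟨ξ 1, h1, ?_⟩
  have hξ : ξ = Finsupp.single 1 (ξ 1) + Finsupp.single 0 (ξ 0) := by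
    ext1 j
    match j with
    | 0 => simp
    | 1 => simp
    | j + 2 => simp [h2 (j + 2) (by omega)]
  rw [hξ, diffOp_add, diffOp_single, diffOp_single, pow_one, pow_zero, mul_one]
  simpa using HasSymbol.mulOp_mul_del_add (ξ 1) (ξ 0)

/-! ### Symbols of eigenvectors -/

theorem choose_mul_eq_of_add_eq_succ {n m N : ℕ} (h : n + m = N + 1) :
    N.choose m * m = N.choose n * n := by
  rcases n with _ | n
  · rw [Nat.choose_eq_zero_of_lt (by omega), zero_mul, mul_zero]
  rcases m with _ | m
  · rw [Nat.choose_eq_zero_of_lt (show N < n + 1 by omega), zero_mul, mul_zero]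
  obtain rfl : N = n + m + 1 := by omega
  rw [← Nat.add_one_mul_choose_eq, ← Nat.add_one_mul_choose_eq, Nat.choose_symm_add]

theorem HasSymbol.eigen {P Q : Module.End ℂ ℂ⟦X⟧} {ξ a : ℂ⟦X⟧} {n : ℕ} {r : ℂ}
    (hP : HasSymbol 1 ξ P) (hQ : HasSymbol n a Q) (h : ⁅P, Q⁆ = r • Q) :
    ξ * PowerSeries.derivative ℂ a = (n : ℂ) • (a * PowerSeries.derivative ℂ ξ) + r • a := by
  have h1 := hP.lie hQ (N := n) (by omega)
  rw [h] at h1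
  have h2 := h1.unique (hQ.smul r)
  rw [Nat.choose_self, Nat.choose_one_right, Nat.cast_one, one_smul] at h2
  rw [← h2]; abel

/-- Substituting the eigenvector equations into ξ times the Poisson bracket leaves terms in abξ'
whose coefficients cancel by `choose_mul_eq_of_add_eq_succ`. As ab ≠ 0 in the applications, σ
vanishes only if the scalar does. -/
theorem HasSymbol.lie_eigen {Q R : Module.End ℂ ℂ⟦X⟧} {ξ a b : ℂ⟦X⟧} {n m N : ℕ} {r s : ℂ}
    (hQ : HasSymbol n a Q) (hR : HasSymbol m b R) (hN : n + m = N + 1)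
    (ha : ξ * PowerSeries.derivative ℂ a = (n : ℂ) • (a * PowerSeries.derivative ℂ ξ) + r • a)
    (hb : ξ * PowerSeries.derivative ℂ b = (m : ℂ) • (b * PowerSeries.derivative ℂ ξ) + s • b) :
    ∃ σ, HasSymbol N σ ⁅Q, R⁆ ∧ ξ * σ = (N.choose m * s - N.choose n * r : ℂ) • (a * b) := by
  refine ⟨_, hQ.lie hR hN, ?_⟩
  have hc := congrArg (fun k : ℕ => PowerSeries.C (k : ℂ)) (choose_mul_eq_of_add_eq_succ hN)
  simp only [PowerSeries.smul_eq_C_mul, map_sub, map_mul, Nat.cast_mul] at ha hb hc ⊢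
  linear_combination PowerSeries.C (N.choose m : ℂ) * a * hb -
    PowerSeries.C (N.choose n : ℂ) * b * ha + a * b * PowerSeries.derivative ℂ ξ * hc

/-! ### Virasoro families have order one -/

/-- A family of differential operators satisfying the relations of the Virasoro algebra, with
the operator for `L_0` of first order. -/
structure IsVirFamily (P : ℤ → Module.End ℂ ℂ⟦X⟧) (Z : Module.End ℂ ℂ⟦X⟧) : Prop where
  mem : ∀ i, P i ∈ Diff
  mem_center : Z ∈ Diff
  lie : ∀ i j : ℤ, ⁅P i, P j⁆ = ((i : ℂ) - (j : ℂ)) • P (i + j) +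
      (if i + j = 0 then (1 / 12 : ℂ) * ((i : ℂ) ^ 3 - (i : ℂ)) else 0) • Z
  lie_center : ∀ i, ⁅P i, Z⁆ = 0
  order : HasOrder (P 0) 1

namespace IsVirFamily

variable {P : ℤ → Module.End ℂ ℂ⟦X⟧} {Z : Module.End ℂ ℂ⟦X⟧} (H : IsVirFamily P Z)
include H

theorem lie_of_ne {i j : ℤ} (h : i + j ≠ 0) :
    ⁅P i, P j⁆ = ((i : ℂ) - (j : ℂ)) • P (i + j) := by
  rw [H.lie, if_neg h, zero_smul, add_zero]

theorem lie_zero (i : ℤ) : ⁅P 0, P i⁆ = (-(i : ℂ)) • P i := by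
  rw [H.lie, zero_add]
  split_ifs with h
  · subst h; simp
  · simp

/-- If Z had positive order, its commutator with P 1 would have a nonzero symbol, because the scalar
in `HasSymbol.lie_eigen` is a positive binomial coefficient. So Z is multiplication by some b, and
commuting with P 0 gives ξb' = 0. -/
theorem exists_center_eq {ξ : ℂ⟦X⟧} (hξ : ξ ≠ 0) (h0 : HasSymbol 1 ξ (P 0)) (hP : P 1 ≠ 0) :
    ∃ κ : ℂ, Z = mulOp (PowerSeries.C κ) := by
  by_cases hZ : Z = 0
  · exact ⟨0, by rw [hZ, map_zero, mulOp_zero]⟩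
  obtain ⟨m, b, hb, hZb⟩ := HasSymbol.exists_of_ne_zero H.mem_center hZ
  obtain ⟨n, a, ha, hPa⟩ := HasSymbol.exists_of_ne_zero (H.mem 1) hP
  have eZ := h0.eigen hZb (r := 0) (by rw [H.lie_center, zero_smul])
  have eP := h0.eigen hPa (H.lie_zero 1)
  obtain rfl : m = 0 := by
    by_contra hm
    obtain ⟨N, hN⟩ : ∃ N, n + m = N + 1 := Nat.exists_eq_succ_of_ne_zero (by omega)
    obtain ⟨σ, hσ, hσ'⟩ := hPa.lie_eigen hZb hN eP eZ
    rw [H.lie_center] at hσ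
    have hσ0 : σ = 0 := by
      by_contra h
      exact hσ.ne_zero h rfl
    rw [hσ0, mul_zero, eq_comm, smul_eq_zero] at hσ'
    have hch : (N.choose n : ℂ) ≠ 0 := by
      exact_mod_cast (Nat.choose_pos (by omega)).ne'
    exact hσ'.elim (by simpa using hch) (mul_ne_zero ha hb)
  have hb' : PowerSeries.derivative ℂ b = 0 := by
    simpa [hξ] using eZ
  refine ⟨PowerSeries.constantCoeff b, ?_⟩
  rw [hZb.eq_mulOp]
  congr 1
  exact PowerSeries.derivative.ext (by rw [hb', PowerSeries.derivative_C]) (by simp)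

theorem apply_one_ne_zero : P 1 ≠ 0 := by
  obtain ⟨ξ, hξ, h0⟩ := H.order.exists_hasSymbol
  intro h
  have h1 := H.lie 1 (-1)
  rw [h, Ring.lie_def, zero_mul, mul_zero, sub_zero] at h1
  have h2 : (2 : ℂ) • P 0 = 0 := by
    rw [h1]; norm_num
  exact h0.ne_zero hξ ((smul_eq_zero.mp h2).resolve_left two_ne_zero)

/-- All operators of a Virasoro family are of first order, and the center acts by a scalar. -/
theorem exists_eq : ∃ (a b : ℤ → ℂ⟦X⟧) (κ : ℂ), (∀ i, a i ≠ 0) ∧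
    (∀ i, P i = mulOp (a i) * del + mulOp (b i)) ∧ Z = mulOp (PowerSeries.C κ) := by
  obtain ⟨ξ, hξ, h0⟩ := H.order.exists_hasSymbol
  obtain ⟨κ, hκ⟩ := H.exists_center_eq hξ h0 H.apply_one_ne_zero
  -- The bracket is 2i P 0 plus a scalar, and the scalar does not affect the symbol of order one.
  have hpair : ∀ i : ℤ, i ≠ 0 → ∃ x : ℂ⟦X⟧, x ≠ 0 ∧ HasSymbol 1 x ⁅P i, P (-i)⁆ := by
    intro i hi
    refine ⟨(2 * i : ℂ) • ξ, by simp [hi, hξ], ?_⟩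
    have hZ : HasSymbol 1 0 Z := hκ ▸ (HasSymbol.mulOp _).of_lt one_pos
    rw [H.lie, add_neg_cancel]
    convert (h0.smul _).add (hZ.smul _) using 1
    rw [smul_zero, add_zero]
    congr 1
    push_cast
    ring
  have hne : ∀ i, P i ≠ 0 := by
    intro i h
    by_cases hi : i = 0
    · subst hi; exact h0.ne_zero hξ h
    · obtain ⟨x, hx, hs⟩ := hpair i hi
      refine hs.ne_zero hx ?_
      rw [h, Ring.lie_def, zero_mul, mul_zero, sub_zero]
  choose n a ha hs using fun i => HasSymbol.exists_of_ne_zero (H.mem i) (hne i)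
  have heig := fun i => h0.eigen (hs i) (H.lie_zero i)
  have hsucc : ∀ i j, ⁅P i, P j⁆ ≠ 0 → ∃ N, n i + n j = N + 1 := by
    intro i j hij
    refine Nat.exists_eq_succ_of_ne_zero fun h => hij ?_
    have hi := hs i
    have hj := hs j
    rw [show n i = 0 by omega] at hi
    rw [show n j = 0 by omega] at hj
    rw [hi.eq_mulOp, hj.eq_mulOp, Ring.lie_def, mulOp_mul_mulOp, mulOp_mul_mulOp, mul_comm,
      sub_self]
  -- The eigenvalues -i and i make the scalar i times a sum of two binomial coefficients, not both
  -- zero; so the bracket has order exactly n i + n (-i) - 1, which must be 1.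
  have hsum : ∀ i : ℤ, i ≠ 0 → n i + n (-i) = 2 := by
    intro i hi
    obtain ⟨x, hx, hsx⟩ := hpair i hi
    obtain ⟨N, hN⟩ := hsucc i (-i) (hsx.ne_zero hx)
    obtain ⟨σ, hσ, hσ'⟩ := (hs i).lie_eigen (hs (-i)) hN (heig i) (heig (-i))
    have hσ0 : σ ≠ 0 := by
      rintro rfl
      rw [mul_zero, eq_comm, smul_eq_zero, or_iff_left (mul_ne_zero (ha i) (ha (-i)))] at hσ'
      have h1 : ((N.choose (n (-i)) + N.choose (n i) : ℕ) : ℂ) * i = 0 := by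
        push_cast at hσ' ⊢
        linear_combination hσ'
      have h2 : N.choose (n (-i)) + N.choose (n i) ≠ 0 := by
        rcases Nat.eq_zero_or_pos (n (-i)) with h | h
        · rw [h, Nat.choose_zero_right]; omega
        · have := Nat.choose_pos (n := N) (k := n i) (by omega)
          omega
      rcases mul_eq_zero.mp h1 with h | h
      · exact h2 (by exact_mod_cast h)
      · exact hi (by exact_mod_cast h)
    have := hσ.le hsx hσ0
    have := hsx.le hσ hx
    omega
  have hle : ∀ i : ℤ, i ≠ 0 → n i + 1 ≤ n (2 * i) + n (-i) := by
    intro i hi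
    have hb : ⁅P (2 * i), P (-i)⁆ = (3 * i : ℂ) • P i := by
      rw [H.lie_of_ne (by omega), show 2 * i + -i = i by ring]
      congr 1
      push_cast
      ring
    have h3 : HasSymbol (n i) ((3 * i : ℂ) • a i) ⁅P (2 * i), P (-i)⁆ := hb ▸ (hs i).smul _
    have h3' : (3 * i : ℂ) • a i ≠ 0 := by simp [hi, ha i]
    obtain ⟨N, hN⟩ := hsucc _ _ (h3.ne_zero h3')
    have := h3.le ((hs (2 * i)).lie (hs (-i)) hN) h3'
    omega
  have hone : ∀ i, n i = 1 := by
    intro i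
    by_cases hi : i = 0
    · subst hi
      have := h0.le (hs 0) hξ
      have := (hs 0).le h0 (ha 0)
      omega
    -- If n i = 2 and n (-i) = 0, `hle` would give n (2i) ≥ 3, against `hsum`; the case (0, 2) is
    -- symmetric.
    · have h1 := hsum i hi
      have h2 := hsum (2 * i) (by omega)
      have h3 := hsum (2 * -i) (by omega)
      have h4 := hle i hi
      have h5 := hle (-i) (by omega)
      rw [neg_neg] at h5
      omega
  choose b hb using fun i => (hone i ▸ hs i : HasSymbol 1 (a i) (P i)).exists_eq
  exact ⟨a, b, κ, ha, hb, hκ⟩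

end IsVirFamily

/-! ### First-order operators, valuations and scalar relations -/

theorem firstOrder_lie (a b a' b' : ℂ⟦X⟧) :
    ⁅mulOp a * del + mulOp b, mulOp a' * del + mulOp b'⁆ =
      mulOp (a * PowerSeries.derivative ℂ a' - a' * PowerSeries.derivative ℂ a) * del +
        mulOp (a * PowerSeries.derivative ℂ b' - a' * PowerSeries.derivative ℂ b) := by
  ext x : 1
  simp only [Ring.lie_def, LinearMap.sub_apply, Module.End.mul_apply, LinearMap.add_apply,
    mulOp_apply, del_apply, map_add, Derivation.leibniz, smul_eq_mul]
  ring

theorem firstOrder_injective {a b a' b' : ℂ⟦X⟧}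
    (h : mulOp a * del + mulOp b = mulOp a' * del + mulOp b') : a = a' ∧ b = b' := by
  have h0 := LinearMap.congr_fun h 1
  have h1 := LinearMap.congr_fun h PowerSeries.X
  simp only [Module.End.mul_apply, LinearMap.add_apply, mulOp_apply, del_apply,
    Derivation.map_one_eq_zero, PowerSeries.derivative_X, mul_zero, zero_add, mul_one] at h0 h1
  subst h0
  exact ⟨add_right_cancel h1, rfl⟩

theorem smul_firstOrder (r : ℂ) (a b : ℂ⟦X⟧) :
    r • (mulOp a * del + mulOp b) =
      mulOp (PowerSeries.C r * a) * del + mulOp (PowerSeries.C r * b) := by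
  rw [← PowerSeries.smul_eq_C_mul, ← PowerSeries.smul_eq_C_mul, mulOp_smul, mulOp_smul,
    smul_mul_assoc, smul_add]

theorem dvd_of_forall_pow_dvd_pow_succ {x y : ℂ⟦X⟧} (hx : x ≠ 0) (hy : y ≠ 0)
    (h : ∀ n, x ^ n ∣ y ^ (n + 1)) : x ∣ y := by
  obtain ⟨m, hm⟩ := IsDiscreteValuationRing.associated_pow_irreducible hx
    (PowerSeries.X_prime (R := ℂ)).irreducible
  obtain ⟨v, hv⟩ := IsDiscreteValuationRing.associated_pow_irreducible hy
    (PowerSeries.X_prime (R := ℂ)).irreducible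
  -- With m and v the valuations of x and y, the exponent m suffices: v ≤ m - 1 would give m² ≤ v(m
  -- + 1) ≤ m² - 1.
  have hmv := h m
  rw [(hm.pow_pow).dvd_iff_dvd_left, (hv.pow_pow).dvd_iff_dvd_right, ← pow_mul, ← pow_mul,
    pow_dvd_pow_iff PowerSeries.X_ne_zero PowerSeries.X_prime.not_isUnit] at hmv
  rw [hm.dvd_iff_dvd_left, hv.dvd_iff_dvd_right]
  refine pow_dvd_pow _ ?_
  by_contra hlt
  nlinarith

theorem eq_linear_of_relations {γ : ℤ → ℂ} {κ : ℂ}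
    (h1 : ∀ i j : ℤ, i + j ≠ 0 → i * γ i - j * γ j = (i - j) * γ (i + j))
    (h2 : ∀ i : ℤ, i * (γ i + γ (-i)) = 1 / 12 * ((i : ℂ) ^ 3 - i) * κ) (h0 : γ 0 = 0) :
    κ = 0 ∧ ∀ i : ℤ, γ i = i * γ 1 := by
  have hm : γ (-1) = -γ 1 := by
    have := h2 1
    push_cast at this
    linear_combination this
  have hi : ∀ i : ℤ, γ i = i * γ 1 := by
    intro i
    by_cases hi0 : i = 0
    · subst hi0; simp [h0]
    by_cases hi1 : i = -1
    · subst hi1; simp [hm]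
    -- Two equations in γ i and γ (i + 1); eliminating γ (i + 1) leaves 2 γ i = 2i γ 1, for every i.
    have e1 := h1 i 1 (by omega)
    have e2 := h1 (i + 1) (-1) (by omega)
    rw [add_neg_cancel_right, hm] at e2
    push_cast at e1 e2
    linear_combination (i + 1 : ℂ) / 2 * e1 + (i - 1 : ℂ) / 2 * e2
  refine ⟨?_, hi⟩
  -- The cocycle vanishes at i = 1; i = 2 is the first index where it detects κ.
  have := h2 2
  rw [hi 2, hi (-2)] at this
  push_cast at this
  linear_combination -2 * this

/-! ### Powers of h -/

namespace Triple

theorem hpow_zero (t : Triple) : t.hpow 0 = 1 := by simp [hpow]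

theorem hpow_one (t : Triple) : t.hpow 1 = t.h := by simp [hpow]

theorem hpow_add (t : Triple) (i j : ℤ) : t.hpow (i + j) = t.hpow i * t.hpow j := by
  simp [hpow, zpow_add]

theorem dh_mul_dhInv (t : Triple) : PowerSeries.derivative ℂ t.h * t.dhInv = 1 :=
  t.isUnit_dh.mul_val_inv

theorem eq_hpow (t : Triple) {g : ℤ → ℂ⟦X⟧} (h0 : g 0 = 1)
    (h : ∀ i, g (i + 1) = g i * t.h) (i : ℤ) : g i = t.hpow i := by
  induction i using Int.induction_on with
  | zero => rw [h0, hpow_zero]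
  | succ i ih => rw [h, ih, hpow_add, hpow_one]
  | pred i ih =>
    refine t.isUnit_h.mul_right_cancel ?_
    rw [← h, ← t.hpow_one, ← hpow_add, sub_add_cancel, ih]

/-- The coefficient `-h/h'` of `∂` in the operator for `L_0`. -/
def vf (t : Triple) : ℂ⟦X⟧ := -(t.h * t.dhInv)

theorem vf_mul_dh (t : Triple) : t.vf * PowerSeries.derivative ℂ t.h = -t.h := by
  rw [vf]
  linear_combination -t.h * t.dh_mul_dhInv

theorem op_eq (t : Triple) (i : ℤ) :
    t.op i = mulOp (t.vf * t.hpow i) * del +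
      mulOp ((t.b + PowerSeries.C ((i : ℂ) * t.c)) * t.hpow i) := by
  rw [op, hpow_add, hpow_one, vf]
  congr 3
  ring

end Triple

/-! ### From a Virasoro family to a triple -/

/-- The symbols of a Virasoro family are `ξ t_i` with `t` a homomorphism from `ℤ` to the units. -/
theorem exists_factor {a : ℤ → ℂ⟦X⟧} (ha : ∀ i, a i ≠ 0)
    (h : ∀ i j : ℤ, a i * PowerSeries.derivative ℂ (a j) - a j * PowerSeries.derivative ℂ (a i) =
      PowerSeries.C ((i : ℂ) - j) * a (i + j)) :
    ∃ t : ℤ → ℂ⟦X⟧, t 0 = 1 ∧ (∀ i j, t (i + j) = t i * t j) ∧ (∀ i, a i = a 0 * t i) ∧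
      ∀ i : ℤ, a 0 * PowerSeries.derivative ℂ (t i) = -PowerSeries.C (i : ℂ) * t i := by
  have h0 : ∀ j : ℤ, a 0 * PowerSeries.derivative ℂ (a j) =
      a j * PowerSeries.derivative ℂ (a 0) - PowerSeries.C (j : ℂ) * a j := by
    intro j
    have := h 0 j
    simp only [Int.cast_zero, zero_sub, map_neg, zero_add] at this
    linear_combination this
  -- Multiply the relation for (i, j) by a 0 and eliminate the derivatives using those for (0, i)
  -- and (0, j).
  have hne : ∀ i j : ℤ, i ≠ j → a i * a j = a 0 * a (i + j) := by
    intro i j hij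
    have hC : PowerSeries.C ((i : ℂ) - j) ≠ 0 := by
      rw [Ne, map_eq_zero_iff _ PowerSeries.C_injective, sub_eq_zero]
      exact_mod_cast hij
    refine mul_left_cancel₀ hC ?_
    have := h i j
    rw [map_sub] at this ⊢
    linear_combination a 0 * this - a i * h0 j + a j * h0 i
  have hmul : ∀ i j : ℤ, a i * a j = a 0 * a (i + j) := by
    intro i j
    by_cases hij : i = j
    · subst hij
      by_cases hi : i = 0
      · subst hi; simp
      -- The diagonal case, where i - j cannot be cancelled, follows from two off-diagonal ones.
      have h1 := hne (2 * i) (-i) (by omega)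
      have h2 := hne i (-i) (by omega)
      rw [show 2 * i + -i = i by ring] at h1
      rw [add_neg_cancel] at h2
      refine mul_left_cancel₀ (ha 0) ?_
      rw [show i + i = 2 * i by ring]
      linear_combination a (2 * i) * h2 - a i * h1
    · exact hne i j hij
  -- Iterating `hmul` gives a_i^(n+1) = a_0^n a_{(n+1)i}.
  have hdvd : ∀ i, a 0 ∣ a i := by
    refine fun i => dvd_of_forall_pow_dvd_pow_succ (ha 0) (ha i) fun n => ⟨a ((n + 1 : ℕ) * i), ?_⟩
    induction n with
    | zero => simp
    | succ n ih =>
      rw [pow_succ, ih, mul_assoc, hmul, pow_succ, mul_assoc]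
      congr 3
      push_cast
      ring
  choose t ht using hdvd
  refine ⟨t, ?_, fun i j => ?_, ht, fun i => ?_⟩
  · exact mul_left_cancel₀ (ha 0) (by rw [← ht, mul_one])
  · have := hmul i j
    rw [ht i, ht j, ht (i + j)] at this
    refine mul_left_cancel₀ (mul_ne_zero (ha 0) (ha 0)) ?_
    linear_combination -this
  · have := h0 i
    rw [ht i, Derivation.leibniz, smul_eq_mul, smul_eq_mul] at this
    refine mul_left_cancel₀ (ha 0) ?_
    linear_combination this

theorem IsVirFamily.exists_triple {P : ℤ → Module.End ℂ ℂ⟦X⟧} {Z : Module.End ℂ ℂ⟦X⟧}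
    (H : IsVirFamily P Z) : Z = 0 ∧ ∃ t : Triple, ∀ i, P i = t.op i := by
  obtain ⟨a, b, κ, ha, hP, rfl⟩ := H.exists_eq
  have hrel : ∀ i j : ℤ,
      (a i * PowerSeries.derivative ℂ (a j) - a j * PowerSeries.derivative ℂ (a i) =
        PowerSeries.C ((i : ℂ) - j) * a (i + j)) ∧
      (a i * PowerSeries.derivative ℂ (b j) - a j * PowerSeries.derivative ℂ (b i) =
        PowerSeries.C ((i : ℂ) - j) * b (i + j) + PowerSeries.C
          ((if i + j = 0 then (1 / 12 : ℂ) * ((i : ℂ) ^ 3 - (i : ℂ)) else 0) * κ)) := by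
    intro i j
    apply firstOrder_injective
    rw [← firstOrder_lie, ← hP, ← hP, H.lie, hP, smul_firstOrder, mulOp_add, ← mulOp_smul,
      PowerSeries.smul_eq_C_mul, map_mul, add_assoc]
  obtain ⟨t, t0, tadd, hat, hdt⟩ := exists_factor ha fun i j => (hrel i j).1
  have tinv : ∀ i, t i * t (-i) = 1 := fun i => by rw [← tadd, add_neg_cancel, t0]
  have tunit : ∀ i, IsUnit (t i) := fun i => IsUnit.of_mul_eq_one _ (tinv i)
  have hd1 : a 0 * PowerSeries.derivative ℂ (t 1) = -t 1 := by simpa using hdt 1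
  have hdunit : IsUnit (PowerSeries.derivative ℂ (t 1)) :=
    isUnit_of_mul_isUnit_right (hd1 ▸ (tunit 1).neg)
  -- The relation with L_0 says that b j / t j and b 0 have the same derivative.
  have hβ : ∀ j, ∃ γ : ℂ, b j = (b 0 + PowerSeries.C γ) * t j := by
    intro j
    have hbj : b j = b j * t (-j) * t j := by
      rw [mul_assoc, mul_comm (t (-j)), tinv, mul_one]
    generalize hβ : b j * t (-j) = β at hbj
    have h1 := (hrel 0 j).2
    have hd : PowerSeries.derivative ℂ β = PowerSeries.derivative ℂ (b 0) := by
      have hz : (if 0 + j = 0 then (1 / 12 : ℂ) * (((0 : ℤ) : ℂ) ^ 3 - ((0 : ℤ) : ℂ)) else 0) =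
          0 := by simp
      rw [hz, zero_mul, map_zero, add_zero, zero_add, hbj, hat j, Derivation.leibniz, smul_eq_mul,
        smul_eq_mul, Int.cast_zero, zero_sub, map_neg] at h1
      refine mul_left_cancel₀ (mul_ne_zero (ha 0) (tunit j).ne_zero) ?_
      linear_combination h1 - β * hdt j
    refine ⟨PowerSeries.constantCoeff (β - b 0), ?_⟩
    rw [hbj]
    congr 1
    rw [← sub_eq_iff_eq_add']
    exact PowerSeries.derivative.ext (by rw [map_sub, hd, sub_self, PowerSeries.derivative_C])
      (by simp)
  choose γ hγ using hβ
  have hγ0 : γ 0 = 0 := by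
    have := hγ 0
    rw [t0, mul_one, left_eq_add] at this
    exact (map_eq_zero_iff _ PowerSeries.C_injective).mp this
  have hrelγ : ∀ i j : ℤ, PowerSeries.C (i * γ i - j * γ j - (i - j) * γ (i + j)) * t (i + j) =
      PowerSeries.C
        ((if i + j = 0 then (1 / 12 : ℂ) * ((i : ℂ) ^ 3 - (i : ℂ)) else 0) * κ) := by
    intro i j
    have := (hrel i j).2
    rw [hγ i, hγ j, hγ (i + j), hat i, hat j, ← sub_eq_iff_eq_add'] at this
    rw [← this]
    simp only [Derivation.leibniz, smul_eq_mul, map_add, map_sub, map_mul,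
      PowerSeries.derivative_C, tadd]
    linear_combination -t i * (b 0 + PowerSeries.C (γ j)) * hdt j +
      t j * (b 0 + PowerSeries.C (γ i)) * hdt i
  obtain ⟨hκ, hlin⟩ := eq_linear_of_relations (γ := γ) (κ := κ)
    (fun i j hij => by
      have := hrelγ i j
      rw [if_neg hij, zero_mul, map_zero, mul_eq_zero, or_iff_left (tunit _).ne_zero] at this
      exact sub_eq_zero.mp ((map_eq_zero_iff _ PowerSeries.C_injective).mp this))
    (fun i => by
      have := hrelγ i (-i)
      rw [add_neg_cancel, if_pos rfl, t0, mul_one, hγ0, mul_zero, sub_zero] at this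
      rw [← PowerSeries.C_injective this]
      push_cast
      ring) hγ0
  refine ⟨by rw [hκ, map_zero, mulOp_zero], ⟨t 1, b 0, γ 1, tunit 1, hdunit⟩, fun i => ?_⟩
  set T : Triple := ⟨t 1, b 0, γ 1, tunit 1, hdunit⟩
  have hT : t i = T.hpow i := T.eq_hpow t0 (fun i => tadd i 1) i
  have hvf : a 0 = T.vf := hdunit.mul_right_cancel (hd1.trans T.vf_mul_dh.symm)
  rw [hP, T.op_eq, hat, hγ, hlin i, hT, hvf]

/-! ### From a triple to a homomorphism -/

namespace Triple

theorem vf_mul_dhpow (t : Triple) (i : ℤ) :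
    t.vf * PowerSeries.derivative ℂ (t.hpow i) = -PowerSeries.C (i : ℂ) * t.hpow i := by
  have step : ∀ i, PowerSeries.derivative ℂ (t.hpow (i + 1)) =
      t.hpow i * PowerSeries.derivative ℂ t.h + t.h * PowerSeries.derivative ℂ (t.hpow i) := by
    intro i
    rw [hpow_add, hpow_one, Derivation.leibniz, smul_eq_mul, smul_eq_mul]
  induction i using Int.induction_on with
  | zero => simp [hpow_zero]
  | succ i ih =>
    rw [step, hpow_add, hpow_one]
    push_cast at ih ⊢
    rw [map_add, map_one]
    linear_combination t.hpow i * t.vf_mul_dh + t.h * ih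
  | pred i ih =>
    have hs := step (-i - 1)
    have hp := t.hpow_add (-i - 1) 1
    rw [sub_add_cancel] at hs hp
    rw [hpow_one] at hp
    refine t.isUnit_h.mul_left_cancel ?_
    rw [hs, hp] at ih
    push_cast at ih ⊢
    rw [map_neg] at ih
    rw [map_sub, map_neg, map_one]
    linear_combination ih - t.hpow (-i - 1) * t.vf_mul_dh

theorem op_lie (t : Triple) (i j : ℤ) :
    ⁅t.op i, t.op j⁆ = ((i : ℂ) - (j : ℂ)) • t.op (i + j) := by
  rw [op_eq, op_eq, op_eq, firstOrder_lie, smul_firstOrder]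
  have hi := t.vf_mul_dhpow i
  have hj := t.vf_mul_dhpow j
  congr 2
  · congr 1
    simp only [Derivation.leibniz, smul_eq_mul, hpow_add, map_sub]
    linear_combination t.vf * t.hpow i * hj - t.vf * t.hpow j * hi
  · simp only [Derivation.leibniz, smul_eq_mul, hpow_add, map_sub, map_add, map_mul,
      PowerSeries.derivative_C, Int.cast_add]
    linear_combination t.hpow i * (t.b + PowerSeries.C (j : ℂ) * PowerSeries.C t.c) * hj -
      t.hpow j * (t.b + PowerSeries.C (i : ℂ) * PowerSeries.C t.c) * hi

theorem op_mem_Diff (t : Triple) (i : ℤ) : t.op i ∈ Diff :=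
  add_mem (mul_mem (mulOp_mem_Diff _) del_mem_Diff) (mulOp_mem_Diff _)

theorem vf_ne_zero (t : Triple) : t.vf ≠ 0 := by
  intro h
  have := t.vf_mul_dh
  rw [h, zero_mul, eq_comm, neg_eq_zero] at this
  exact t.isUnit_h.ne_zero this

theorem hasOrder_op_zero (t : Triple) : HasOrder (t.op 0) 1 := by
  refine ⟨Finsupp.single 1 t.vf + Finsupp.single 0 t.b, ?_, ?_, fun j hj => ?_⟩
  · rw [op_eq, diffOp_add, diffOp_single, diffOp_single]
    simp [hpow_zero]
  · simpa using t.vf_ne_zero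
  · rw [Finsupp.add_apply, Finsupp.single_eq_of_ne (by omega),
      Finsupp.single_eq_of_ne (by omega), add_zero]

/-- The operator for i = 0 gives -h/h' and b; dividing, the one for i = 1 gives h and then c. -/
theorem op_injective {t s : Triple} (hts : ∀ i, t.op i = s.op i) : t = s := by
  have h0 := hts 0
  have h1 := hts 1
  rw [op_eq, op_eq] at h0 h1
  obtain ⟨hv, hb⟩ := firstOrder_injective h0
  obtain ⟨hh, hc⟩ := firstOrder_injective h1
  simp only [hpow_zero, hpow_one, mul_one, Int.cast_zero, Int.cast_one, zero_mul, one_mul,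
    map_zero, add_zero] at hv hb hh hc
  rw [hv] at hh
  have hh' := mul_left_cancel₀ s.vf_ne_zero hh
  rw [hh', hb] at hc
  have hc' := PowerSeries.C_injective (add_left_cancel (s.isUnit_h.mul_right_cancel hc))
  cases t; cases s
  simp_all

/-- The homomorphism from the Witt algebra attached to a triple. -/
def wittHom (t : Triple) : Witt →ₗ⁅ℂ⁆ Diff :=
  { Witt.basis.constr ℂ fun i => (⟨t.op i, t.op_mem_Diff i⟩ : Diff) with
    map_lie' := by
      set f : Witt →ₗ[ℂ] Diff := Witt.basis.constr ℂ fun i => (⟨t.op i, t.op_mem_Diff i⟩ : Diff)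
      have hf : ∀ i, f (Witt.L i) = ⟨t.op i, t.op_mem_Diff i⟩ := fun i =>
        Module.Basis.constr_basis _ _ _ _
      intro x y
      change f ⁅x, y⁆ = ⁅f x, f y⁆
      induction x using Witt.induction with
      | h0 => simp
      | hadd x x' hx hx' => simp only [add_lie, map_add, hx, hx']
      | hL a i =>
        induction y using Witt.induction with
        | h0 => simp
        | hadd y y' hy hy' => simp only [lie_add, map_add, hy, hy']
        | hL b j =>
          simp only [smul_lie, lie_smul, map_smul, Witt.lie_L, hf]
          congr 2
          exact Subtype.ext (t.op_lie i j).symm }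

theorem wittHom_L (t : Triple) (i : ℤ) :
    (t.wittHom (Witt.L i) : Module.End ℂ ℂ⟦X⟧) = t.op i :=
  congrArg Subtype.val (Module.Basis.constr_basis Witt.basis ℂ
    (fun i => (⟨t.op i, t.op_mem_Diff i⟩ : Diff)) i)

end Triple

/-! ### Homomorphisms and the two bijections -/

theorem Witt.lieHom_ext {ρ σ : Witt →ₗ⁅ℂ⁆ Diff} (h : ∀ i, ρ (Witt.L i) = σ (Witt.L i)) :
    ρ = σ := by
  refine LieHom.ext fun x => ?_
  induction x using Witt.induction with
  | h0 => simp
  | hadd x y hx hy => rw [map_add, map_add, hx, hy]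
  | hL a i => rw [map_smul, map_smul, h]

namespace Vir

theorem induction {p : Vir → Prop} (x : Vir) (hadd : ∀ x y, p x → p y → p (x + y))
    (hL : ∀ (a : ℂ) (i : ℤ), p (a • L i)) (hK : ∀ a : ℂ, p (a • K)) : p x := by
  obtain ⟨⟨w, m⟩, rfl⟩ := (LieAlgebra.ofProd psi).surjective x
  have h1 : p (LieAlgebra.ofProd psi (w, 0)) := by
    induction w using Witt.induction with
    | h0 =>
      have := hK 0
      rwa [zero_smul] at this
    | hadd x y hx hy =>
      have := hadd _ _ hx hy
      rwa [← LieAlgebra.of_add, Prod.mk_add_mk, add_zero] at this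
    | hL a i =>
      have := hL a i
      rwa [L, ← LieAlgebra.of_smul, Prod.smul_mk, smul_zero] at this
  have h2 : p (LieAlgebra.ofProd psi (0, m)) := by
    have := hK (TrivialLieModule.equiv ℂ Witt ℂ m)
    rw [K, ← LieAlgebra.of_smul, Prod.smul_mk, smul_zero, centerOne, ← map_smul, smul_eq_mul,
      mul_one, LinearEquiv.symm_apply_apply] at this
    exact this
  have := hadd _ _ h1 h2
  rwa [← LieAlgebra.of_add, Prod.mk_add_mk, add_zero, zero_add] at this

theorem lieHom_ext {ρ σ : Vir →ₗ⁅ℂ⁆ Diff} (h : ∀ i, ρ (L i) = σ (L i)) (hK : ρ K = σ K) :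
    ρ = σ := by
  refine LieHom.ext fun x => ?_
  induction x using Vir.induction with
  | hadd x y hx hy => rw [map_add, map_add, hx, hy]
  | hL a i => rw [map_smul, map_smul, h]
  | hK a => rw [map_smul, map_smul, hK]

/-- The projection of the Virasoro algebra onto the Witt algebra. -/
def toWitt : Vir →ₗ⁅ℂ⁆ Witt where
  toFun x := ((LieAlgebra.ofProd psi).symm x).1
  map_add' _ _ := by simp
  map_smul' _ _ := by simp
  map_lie' := by simp [LieAlgebra.bracket_ofTwoCocycle]

theorem toWitt_L (i : ℤ) : toWitt (L i) = Witt.L i := rfl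

theorem toWitt_K : toWitt K = 0 := rfl

end Vir

/-- Taking Z = 0 lets the classification of Virasoro families cover the Witt case too. -/
theorem isVirFamily_of_witt (ρ : WittHoms) :
    IsVirFamily (fun i => (ρ.1 (Witt.L i) : Module.End ℂ ℂ⟦X⟧)) 0 where
  mem i := (ρ.1 (Witt.L i)).2
  mem_center := zero_mem _
  lie i j := by
    have := congrArg (Subtype.val : Diff → _) (ρ.1.map_lie (Witt.L i) (Witt.L j))
    rw [Witt.lie_L, map_smul] at this
    rw [smul_zero, add_zero]
    exact this.symm
  lie_center i := by rw [Ring.lie_def, mul_zero, zero_mul, sub_zero]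
  order := ρ.2

theorem isVirFamily_of_vir (ρ : VirHoms) :
    IsVirFamily (fun i => (ρ.1 (Vir.L i) : Module.End ℂ ℂ⟦X⟧)) (ρ.1 Vir.K) where
  mem i := (ρ.1 (Vir.L i)).2
  mem_center := (ρ.1 Vir.K).2
  lie i j := by
    have := congrArg (Subtype.val : Diff → _) (ρ.1.map_lie (Vir.L i) (Vir.L j))
    rw [Vir.lie_L, map_add, map_smul, map_smul] at this
    exact this.symm
  lie_center i := by
    have := congrArg (Subtype.val : Diff → _) (ρ.1.map_lie (Vir.L i) Vir.K)
    rw [Vir.lie_K, map_zero] at this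
    exact this.symm
  order := ρ.2

namespace Triple

/-- The homomorphism from the Witt algebra attached to a triple, with `L_0` of first order. -/
def toWittHoms (t : Triple) : WittHoms :=
  ⟨t.wittHom, by rw [wittHom_L]; exact t.hasOrder_op_zero⟩

/-- The homomorphism from the Virasoro algebra attached to a triple, with `L_0` of first order. -/
def toVirHoms (t : Triple) : VirHoms :=
  ⟨t.wittHom.comp Vir.toWitt, by
    rw [LieHom.comp_apply, Vir.toWitt_L, wittHom_L]; exact t.hasOrder_op_zero⟩

theorem toVirHoms_L (t : Triple) (i : ℤ) :
    (t.toVirHoms.1 (Vir.L i) : Module.End ℂ ℂ⟦X⟧) = t.op i := t.wittHom_L i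

theorem toVirHoms_K (t : Triple) : t.toVirHoms.1 Vir.K = 0 := by
  rw [toVirHoms, LieHom.comp_apply, Vir.toWitt_K, map_zero]

theorem toWittHoms_bijective : Function.Bijective toWittHoms := by
  refine ⟨fun t s h => op_injective fun i => ?_, fun ρ => ?_⟩
  · rw [← wittHom_L, ← wittHom_L, show t.wittHom = s.wittHom from congrArg Subtype.val h]
  · obtain ⟨-, t, ht⟩ := (isVirFamily_of_witt ρ).exists_triple
    exact ⟨t, Subtype.ext (Witt.lieHom_ext fun i =>
      Subtype.ext ((t.wittHom_L i).trans (ht i).symm))⟩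

theorem toVirHoms_bijective : Function.Bijective toVirHoms := by
  refine ⟨fun t s h => op_injective fun i => ?_, fun ρ => ?_⟩
  · rw [← toVirHoms_L, ← toVirHoms_L, h]
  · obtain ⟨hK, t, ht⟩ := (isVirFamily_of_vir ρ).exists_triple
    exact ⟨t, Subtype.ext (Vir.lieHom_ext
      (fun i => Subtype.ext ((t.toVirHoms_L i).trans (ht i).symm))
      (t.toVirHoms_K.trans (Subtype.ext hK.symm)))⟩

end Triple

end WittDiff

end

theorem mainTheorem4 :
    (∃ e : WittDiff.Triple ≃ WittDiff.WittHoms,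
      ∀ (t : WittDiff.Triple) (i : ℤ),
        ((e t).1 (WittDiff.Witt.L i) : Module.End ℂ (PowerSeries ℂ)) = t.op i) ∧
    (∃ e : WittDiff.Triple ≃ WittDiff.VirHoms,
      ∀ t : WittDiff.Triple,
        (∀ i : ℤ, ((e t).1 (WittDiff.Vir.L i) : Module.End ℂ (PowerSeries ℂ)) = t.op i) ∧
        (e t).1 WittDiff.Vir.K = 0) :=
  ⟨⟨Equiv.ofBijective _ WittDiff.Triple.toWittHoms_bijective, WittDiff.Triple.wittHom_L⟩,
    ⟨Equiv.ofBijective _ WittDiff.Triple.toVirHoms_bijective,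
      fun t => ⟨t.toVirHoms_L, t.toVirHoms_K⟩⟩⟩
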